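/- Let $\Bbbk$ be an algebraically closed field of characteristic $0$, and let $\mathcal{C}$ be a multifusion category over $\Bbbk$: an abelian, $\Bbbk$-linear monoidal, rigid, semisimple category with finite-dimensional Hom-spaces, all objects of finite length, enough projectives and finitely many isomorphism classes of simple objects. Let $A$ be an algebra in $\mathcal{C}$. Write $\mathsf{Mod}\text{-}A(\mathcal{C})$ (resp. $A\text{-}\mathsf{Mod}(\mathcal{C})$) for the category of right (resp. left) $A$-modules in $\mathcal{C}$, regarded as a left (resp. right) $\mathcal{C}$-module category via $X\triangleright M=X\otimes M$ (resp. $N\triangleleft X=N\otimes X$). For $M\in\mathsf{Mod}\text{-}A(\mathcal{C})$ let $\underline{\mathrm{Hom}}(M,-)$ be the right adjoint of $(-\otimes M):\mathcal{C}\to\mathsf{Mod}\text{-}A(\mathcal{C})$, and let $\underline{\mathrm{End}}_{\mathsf{Mod}\text{-}A(\mathcal{C})}(M)=\underline{\mathrm{Hom}}(M,M)$ be the internal End, with its algebra structure in $\mathcal{C}$ induced by evaluation; for $N\in A\text{-}\mathsf{Mod}(\mathcal{C})$ define $\underline{\mathrm{End}}_{A\text{-}\mathsf{Mod}(\mathcal{C})}(N)$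 likewise from the right adjoint of $(N\otimes -):\mathcal{C}\to A\text{-}\mathsf{Mod}(\mathcal{C})$. A non-zero algebra is a right (resp. left) simplistic division algebra if its regular right (resp. left) module is simple. A module category is indecomposable if it is not the direct sum of two non-zero module subcategories. (i) If $\mathsf{Mod}\text{-}A(\mathcal{C})$ is semisimple, non-zero and indecomposable as a left $\mathcal{C}$-module category, then for every right $A$-module $M$ in $\mathcal{C}$, $\underline{\mathrm{End}}_{\mathsf{Mod}\text{-}A(\mathcal{C})}(M)$ is a right simplistic division algebra if and only if $M$ is simple in $\mathsf{Mod}\text{-}A(\mathcal{C})$. (ii) If $A\text{-}\mathsf{Mod}(\mathcal{C})$ is semisimple, non-zero and indecomposable as a right $\mathcal{C}$-module category, then for every left $A$-module $N$ in $\mathcal{C}$, $\underline{\mathrm{End}}_{A\text{-}\mathsf{Mod}(\mathcal{C})}(N)$ is a left simplistic division algebra if and only if $N$ is simple in $A\text{-}\mathsf{Mod}(\mathcal{C})$. -/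

import Mathlib

open CategoryTheory CategoryTheory.Limits MonoidalCategory

universe w v v₂ u u₂

namespace DivAlg

/-! ### Right and left modules over an algebra

Algebras in a monoidal category are Mathlib's `MonObj`, and left modules are Mathlib's `Mod C A`. -/

section RightModules

variable {C : Type u} [Category.{v} C] [MonoidalCategory C]

/-- A right module `(X, act)` over the algebra `A` in `C`. -/
structure RightMod (A : C) [MonObj A] where
  X : C
  act : X ⊗ A ⟶ X
  act_one : X ◁ (MonObj.one : 𝟙_ C ⟶ A) ≫ act = (ρ_ X).hom
  act_mul : X ◁ (MonObj.mul : A ⊗ A ⟶ A) ≫ act = (α_ X A A).inv ≫ act ▷ A ≫ act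

namespace RightMod

variable {A : C} [MonObj A]

/-- Morphisms of right `A`-modules. -/
@[ext]
structure Hom (M N : RightMod A) where
  hom : M.X ⟶ N.X
  act_hom : M.act ≫ hom = hom ▷ A ≫ N.act

instance : Category (RightMod A) where
  Hom M N := Hom M N
  id M := ⟨𝟙 M.X, by simp⟩
  comp f g := ⟨f.hom ≫ g.hom, by
    rw [← Category.assoc, f.act_hom, Category.assoc, g.act_hom, comp_whiskerRight,
      Category.assoc]⟩

@[ext]
theorem hom_ext {M N : RightMod A} (f g : M ⟶ N) (h : f.hom = g.hom) : f = g := Hom.ext h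

@[simp]
theorem id_hom (M : RightMod A) : (𝟙 M : M ⟶ M).hom = 𝟙 M.X := rfl

@[simp]
theorem comp_hom {M N K : RightMod A} (f : M ⟶ N) (g : N ⟶ K) :
    (f ≫ g).hom = f.hom ≫ g.hom := rfl

/-- An isomorphism of right modules from an isomorphism in `C` that respects the actions. -/
@[simps]
def mkIso {M N : RightMod A} (e : M.X ≅ N.X) (h : M.act ≫ e.hom = e.hom ▷ A ≫ N.act) :
    M ≅ N where
  hom := ⟨e.hom, h⟩
  inv := ⟨e.inv, by
    rw [← cancel_mono e.hom, Category.assoc, Category.assoc, h, Iso.inv_hom_id, Category.comp_id,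
      ← Category.assoc, ← comp_whiskerRight, Iso.inv_hom_id, id_whiskerRight, Category.id_comp]⟩
  hom_inv_id := by ext; simp
  inv_hom_id := by ext; simp

variable (A) in
/-- The regular right module of `A`. -/
@[simps]
def regular : RightMod A where
  X := A
  act := MonObj.mul
  act_one := MonObj.mul_one A
  act_mul := by simp [MonObj.mul_assoc]

/-- The right module `X ⊗ M`. -/
@[simps]
def tensor (X : C) (M : RightMod A) : RightMod A where
  X := X ⊗ M.X
  act := (α_ X M.X A).hom ≫ X ◁ M.act
  act_one := by
    have h := congrArg (fun f => X ◁ f) M.act_one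
    simp only [MonoidalCategory.whiskerLeft_comp] at h
    simp [h]
  act_mul := by
    have h := congrArg (fun f => X ◁ f) M.act_mul
    simp only [MonoidalCategory.whiskerLeft_comp] at h
    simp [h]

theorem whiskerRight_act {X Y : C} (f : X ⟶ Y) (M : RightMod A) :
    ((α_ X M.X A).hom ≫ X ◁ M.act) ≫ f ▷ M.X
      = (f ▷ M.X) ▷ A ≫ (α_ Y M.X A).hom ≫ Y ◁ M.act := by
  simp [whisker_exchange]

theorem whiskerLeft_act (X : C) {M N : RightMod A} (f : M ⟶ N) :
    ((α_ X M.X A).hom ≫ X ◁ M.act) ≫ X ◁ f.hom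
      = (X ◁ f.hom) ▷ A ≫ (α_ X N.X A).hom ≫ X ◁ N.act := by
  have h := congrArg (fun f => X ◁ f) f.act_hom
  simp only [MonoidalCategory.whiskerLeft_comp] at h
  simp [h]

theorem associator_act (X Y : C) (M : RightMod A) :
    ((α_ (X ⊗ Y) M.X A).hom ≫ (X ⊗ Y) ◁ M.act) ≫ (α_ X Y M.X).hom
      = (α_ X Y M.X).hom ▷ A ≫ (α_ X (Y ⊗ M.X) A).hom ≫
        X ◁ ((α_ Y M.X A).hom ≫ Y ◁ M.act) := by
  simp

theorem leftUnitor_act (M : RightMod A) :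
    ((α_ (𝟙_ C) M.X A).hom ≫ 𝟙_ C ◁ M.act) ≫ (λ_ M.X).hom = (λ_ M.X).hom ▷ A ≫ M.act := by
  simp

/-- The left `C`-module category of right `A`-modules. -/
instance : MonoidalLeftAction C (RightMod A) where
  actionObj X M := tensor X M
  actionHomLeft f M := ⟨f ▷ M.X, whiskerRight_act f M⟩
  actionHomRight X _ _ f := ⟨X ◁ f.hom, whiskerLeft_act X f⟩
  actionHom f g := ⟨f ⊗ₘ g.hom, by
    rw [MonoidalCategory.tensorHom_def]
    exact (Hom.mk (M := tensor _ _) (N := tensor _ _) _ (whiskerRight_act f _) ≫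
      Hom.mk (M := tensor _ _) (N := tensor _ _) _ (whiskerLeft_act _ g) :
        tensor _ _ ⟶ tensor _ _).act_hom⟩
  actionAssocIso X Y M := mkIso (α_ X Y M.X) (associator_act X Y M)
  actionUnitIso M := mkIso (λ_ M.X) (leftUnitor_act M)
  actionHom_def f g := hom_ext _ _ (MonoidalCategory.tensorHom_def _ _)
  actionHomRight_id X M := hom_ext _ _ (MonoidalCategory.whiskerLeft_id _ _)
  id_actionHomLeft X M := hom_ext _ _ (MonoidalCategory.id_whiskerRight _ _)
  actionHom_comp f₁ f₂ g₁ g₂ := hom_ext _ _ (MonoidalCategory.tensorHom_comp_tensorHom _ _ _ _).symm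
  actionAssocIso_hom_naturality f g h := hom_ext _ _ (MonoidalCategory.associator_naturality _ _ _)
  actionUnitIso_hom_naturality f := hom_ext _ _ (MonoidalCategory.leftUnitor_naturality f.hom).symm
  whiskerLeft_actionHomLeft X _ _ f M := hom_ext _ _ (MonoidalCategory.whisker_assoc X f M.X)
  whiskerRight_actionHomLeft Y f M :=
    hom_ext _ _ (by
      change f ▷ Y ▷ M.X = (α_ _ _ _).hom ≫ f ▷ (Y ⊗ M.X) ≫ (α_ _ _ _).inv
      simp)
  associator_actionHom X Y Z M := hom_ext _ _ (MonoidalCategory.pentagon X Y Z M.X)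
  leftUnitor_actionHom X M := hom_ext _ _ (MonoidalCategory.leftUnitor_whiskerRight X M.X)
  rightUnitor_actionHom X M := hom_ext _ _ (MonoidalCategory.triangle X M.X).symm

end RightMod

end RightModules

section LeftModules

variable {C : Type u} [Category.{v} C] [MonoidalCategory C] {A : C} [MonObj A]

namespace LeftMod

/-- The action map of a left module. -/
abbrev act (M : Mod C A) : A ⊗ M.X ⟶ M.X := ModObj.smul (M := A) (X := M.X)

theorem hom_act {M N : Mod C A} (f : M ⟶ N) : act M ≫ f.hom = A ◁ f.hom ≫ act N :=
  IsModHom.smul_hom (A := A) (f := f.hom)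

/-- A morphism of left modules from a morphism in `C` that respects the actions. -/
def mkHom {M N : Mod C A} (f : M.X ⟶ N.X) (h : act M ≫ f = A ◁ f ≫ act N) : M ⟶ N :=
  Mod.Hom.mk' f h

@[simp]
theorem mkHom_hom {M N : Mod C A} (f : M.X ⟶ N.X) (h : act M ≫ f = A ◁ f ≫ act N) :
    (mkHom f h).hom = f := rfl

/-- An isomorphism of left modules from an isomorphism in `C` that respects the actions. -/
@[simps]
def mkIso {M N : Mod C A} (e : M.X ≅ N.X) (h : act M ≫ e.hom = A ◁ e.hom ≫ act N) : M ≅ N where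
  hom := mkHom e.hom h
  inv := mkHom e.inv (by
    rw [← cancel_mono e.hom, Category.assoc, Category.assoc, h, Iso.inv_hom_id, Category.comp_id,
      ← Category.assoc, ← MonoidalCategory.whiskerLeft_comp, Iso.inv_hom_id,
      MonoidalCategory.whiskerLeft_id, Category.id_comp])
  hom_inv_id := by ext; simp
  inv_hom_id := by ext; simp

theorem one_act (M : Mod C A) :
    (MonObj.one : 𝟙_ C ⟶ A) ▷ M.X ≫ act M = (λ_ M.X).hom := ModObj.one_smul_self A M.X

theorem mul_act (M : Mod C A) :
    (MonObj.mul : A ⊗ A ⟶ A) ▷ M.X ≫ act M = (α_ A A M.X).hom ≫ A ◁ act M ≫ act M :=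
  ModObj.mul_smul_self A M.X

theorem one_tensorAct (M : Mod C A) (X : C) :
    (MonObj.one : 𝟙_ C ⟶ A) ▷ (M.X ⊗ X) ≫ (α_ A M.X X).inv ≫ act M ▷ X
      = (λ_ (M.X ⊗ X)).hom := by
  have h := congrArg (fun f => f ▷ X) (one_act M)
  simp only [comp_whiskerRight] at h
  simp [h]

theorem mul_tensorAct (M : Mod C A) (X : C) :
    (MonObj.mul : A ⊗ A ⟶ A) ▷ (M.X ⊗ X) ≫ (α_ A M.X X).inv ≫ act M ▷ X
      = (α_ A A (M.X ⊗ X)).hom ≫ A ◁ ((α_ A M.X X).inv ≫ act M ▷ X) ≫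
        (α_ A M.X X).inv ≫ act M ▷ X := by
  have h := congrArg (fun f => f ▷ X) (mul_act M)
  simp only [comp_whiskerRight] at h
  simp [h]

/-- The left module `M ⊗ X`. -/
def tensor (M : Mod C A) (X : C) : Mod C A where
  X := M.X ⊗ X
  mod :=
    { smul := (α_ A M.X X).inv ≫ act M ▷ X
      one_smul := one_tensorAct M X
      mul_smul := mul_tensorAct M X }

theorem act_whiskerLeft (M : Mod C A) {X Y : C} (f : X ⟶ Y) :
    ((α_ A M.X X).inv ≫ act M ▷ X) ≫ M.X ◁ f
      = A ◁ (M.X ◁ f) ≫ (α_ A M.X Y).inv ≫ act M ▷ Y := by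
  simp [← whisker_exchange]

theorem act_whiskerRight {M N : Mod C A} (f : M ⟶ N) (X : C) :
    ((α_ A M.X X).inv ≫ act M ▷ X) ≫ f.hom ▷ X
      = A ◁ (f.hom ▷ X) ≫ (α_ A N.X X).inv ≫ act N ▷ X := by
  have h := congrArg (fun f => f ▷ X) (hom_act f)
  simp only [comp_whiskerRight] at h
  simp [h]

theorem act_associator (M : Mod C A) (X Y : C) :
    ((α_ A M.X (X ⊗ Y)).inv ≫ act M ▷ (X ⊗ Y)) ≫ (α_ M.X X Y).inv
      = A ◁ (α_ M.X X Y).inv ≫ (α_ A (M.X ⊗ X) Y).inv ≫ ((α_ A M.X X).inv ≫ act M ▷ X) ▷ Y := by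
  simp

theorem act_rightUnitor (M : Mod C A) :
    ((α_ A M.X (𝟙_ C)).inv ≫ act M ▷ 𝟙_ C) ≫ (ρ_ M.X).hom = A ◁ (ρ_ M.X).hom ≫ act M := by
  simp

/-- The right `C`-module category of left `A`-modules. -/
instance : MonoidalRightAction C (Mod C A) where
  actionObj M X := tensor M X
  actionHomRight M X Y f := mkHom (M := tensor M X) (N := tensor M Y) (M.X ◁ f)
    (act_whiskerLeft M f)
  actionHomLeft {M N} f X := mkHom (M := tensor M X) (N := tensor N X) (f.hom ▷ X)
    (act_whiskerRight f X)
  actionHom {X Y M N} f g := mkHom (M := tensor M X) (N := tensor N Y) (f.hom ⊗ₘ g) (by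
    rw [MonoidalCategory.tensorHom_def]
    exact hom_act (mkHom (M := tensor M X) (N := tensor N X) _ (act_whiskerRight f X) ≫
      mkHom (M := tensor N X) (N := tensor N Y) _ (act_whiskerLeft N g)))
  actionAssocIso M X Y := mkIso (M := tensor M (X ⊗ Y)) (N := tensor (tensor M X) Y)
    (α_ M.X X Y).symm (act_associator M X Y)
  actionUnitIso M := mkIso (M := tensor M (𝟙_ C)) (N := M) (ρ_ M.X) (act_rightUnitor M)
  actionHom_def f g := Mod.hom_ext _ _ (MonoidalCategory.tensorHom_def _ _)
  actionHomRight_id X M := Mod.hom_ext _ _ (MonoidalCategory.whiskerLeft_id _ _)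
  id_actionHomLeft X M := Mod.hom_ext _ _ (MonoidalCategory.id_whiskerRight _ _)
  actionHom_comp f₁ f₂ g₁ g₂ :=
    Mod.hom_ext _ _ (MonoidalCategory.tensorHom_comp_tensorHom _ _ _ _).symm
  actionAssocIso_hom_naturality f g h :=
    Mod.hom_ext _ _ (MonoidalCategory.associator_inv_naturality _ _ _)
  actionUnitIso_hom_naturality f :=
    Mod.hom_ext _ _ (MonoidalCategory.rightUnitor_naturality f.hom).symm
  actionHomRight_whiskerRight f X M :=
    Mod.hom_ext _ _ (by
      change M.X ◁ (f ▷ X) = (α_ _ _ _).inv ≫ (M.X ◁ f) ▷ X ≫ (α_ _ _ _).hom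
      simp)
  whiskerRight_actionHomLeft X _ _ f M :=
    Mod.hom_ext _ _ (by
      change M.X ◁ (X ◁ f) = (α_ _ _ _).inv ≫ (M.X ⊗ X) ◁ f ≫ (α_ _ _ _).hom
      simp)
  actionHom_associator X Y Z M :=
    Mod.hom_ext _ _ (by
      change M.X ◁ (α_ X Y Z).hom ≫ (α_ _ _ _).inv ≫ (α_ _ _ _).inv
        = (α_ _ _ _).inv ≫ (α_ _ _ _).inv ▷ Z
      simp)
  actionHom_leftUnitor X M :=
    Mod.hom_ext _ _ (by
      change M.X ◁ (λ_ X).hom = (α_ _ _ _).inv ≫ (ρ_ M.X).hom ▷ X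
      simp)
  actionHom_rightUnitor X M :=
    Mod.hom_ext _ _ (by
      change M.X ◁ (ρ_ X).hom = (α_ _ _ _).inv ≫ (ρ_ (M.X ⊗ X)).hom
      simp)

end LeftMod

end LeftModules

/-! ### The additive structure on categories of modules -/

section Preadditive

variable {C : Type u} [Category.{v} C] [Preadditive C] [MonoidalCategory C] [MonoidalPreadditive C]
  {A : C} [MonObj A]

instance (M N : RightMod A) : Add (M ⟶ N) where
  add f g := ⟨f.hom + g.hom, by simp [f.act_hom, g.act_hom, MonoidalPreadditive.add_whiskerRight]⟩

instance (M N : RightMod A) : Zero (M ⟶ N) where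
  zero := ⟨0, by simp⟩

instance (M N : RightMod A) : Neg (M ⟶ N) where
  neg f := ⟨-f.hom, by
    have h : (-f.hom) ▷ A = -(f.hom ▷ A) := ((tensoringRight C).obj A).map_neg
    rw [h]; simp [f.act_hom]⟩

instance (M N : RightMod A) : AddCommGroup (M ⟶ N) where
  nsmul := nsmulRec
  zsmul := zsmulRec
  add_assoc f g h := RightMod.hom_ext _ _ (add_assoc f.hom g.hom h.hom)
  zero_add f := RightMod.hom_ext _ _ (zero_add f.hom)
  add_zero f := RightMod.hom_ext _ _ (add_zero f.hom)
  neg_add_cancel f := RightMod.hom_ext _ _ (neg_add_cancel f.hom)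
  add_comm f g := RightMod.hom_ext _ _ (add_comm f.hom g.hom)

instance : Preadditive (RightMod A) where
  add_comp _ _ _ f g h := RightMod.hom_ext _ _ (Preadditive.add_comp _ _ _ f.hom g.hom h.hom)
  comp_add _ _ _ f g h := RightMod.hom_ext _ _ (Preadditive.comp_add _ _ _ f.hom g.hom h.hom)

instance (M N : Mod C A) : Add (M ⟶ N) where
  add f g := LeftMod.mkHom (f.hom + g.hom) (by
    rw [MonoidalPreadditive.whiskerLeft_add, Preadditive.comp_add, Preadditive.add_comp,
      LeftMod.hom_act, LeftMod.hom_act])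

instance (M N : Mod C A) : Zero (M ⟶ N) where
  zero := LeftMod.mkHom 0 (by rw [MonoidalPreadditive.whiskerLeft_zero, comp_zero, zero_comp])

instance (M N : Mod C A) : Neg (M ⟶ N) where
  neg f := LeftMod.mkHom (-f.hom) (by
    have h : A ◁ (-f.hom) = -(A ◁ f.hom) := ((tensoringLeft C).obj A).map_neg
    rw [h, Preadditive.comp_neg, Preadditive.neg_comp, LeftMod.hom_act])

instance (M N : Mod C A) : AddCommGroup (M ⟶ N) where
  nsmul := nsmulRec
  zsmul := zsmulRec
  add_assoc f g h := Mod.hom_ext _ _ (add_assoc f.hom g.hom h.hom)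
  zero_add f := Mod.hom_ext _ _ (zero_add f.hom)
  add_zero f := Mod.hom_ext _ _ (add_zero f.hom)
  neg_add_cancel f := Mod.hom_ext _ _ (neg_add_cancel f.hom)
  add_comm f g := Mod.hom_ext _ _ (add_comm f.hom g.hom)

theorem LeftMod.add_hom {M N : Mod C A} (f g : M ⟶ N) : (f + g).hom = f.hom + g.hom := rfl

instance : Preadditive (Mod C A) where
  add_comp _ _ _ f g h := Mod.hom_ext _ _ (by
    rw [Mod.comp_hom', LeftMod.add_hom, LeftMod.add_hom, Preadditive.add_comp,
      Mod.comp_hom', Mod.comp_hom'])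
  comp_add _ _ _ f g h := Mod.hom_ext _ _ (by
    rw [Mod.comp_hom', LeftMod.add_hom, LeftMod.add_hom, Preadditive.comp_add,
      Mod.comp_hom', Mod.comp_hom'])

end Preadditive

/-! ### Closed module categories, internal Homs and internal Ends -/

section ClosedLeft

variable (C : Type u) [Category.{v} C] [MonoidalCategory C]
  (D : Type u₂) [Category.{v₂} D] [MonoidalLeftAction C D]

/-- A left `C`-module category is closed if every functor `X ↦ X ▷ M` has a right adjoint. -/
class IsClosedLeft : Prop where
  isLeftAdjoint (M : D) : (MonoidalLeftAction.actionRight C M).IsLeftAdjoint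

attribute [instance] IsClosedLeft.isLeftAdjoint

variable {D} [IsClosedLeft C D]

open MonoidalLeftAction

/-- The internal Hom functor of an object of a closed left `C`-module category. -/
noncomputable def leftHom (M : D) : D ⥤ C := (actionRight C M).rightAdjoint

/-- The adjunction defining the internal Hom. -/
noncomputable def leftHomAdj (M : D) : actionRight C M ⊣ leftHom C M :=
  Adjunction.ofIsLeftAdjoint _

/-- The evaluation `Hom(M, N) ▷ M ⟶ N`. -/
noncomputable def leftEv (M N : D) : ((leftHom C M).obj N) ⊙ₗ M ⟶ N :=
  (leftHomAdj C M).counit.app N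

variable {C}

/-- The morphism `X ⟶ Hom(M, N)` corresponding to `X ▷ M ⟶ N`. -/
noncomputable def leftCurry {M N : D} {X : C} (f : X ⊙ₗ M ⟶ N) : X ⟶ (leftHom C M).obj N :=
  (leftHomAdj C M).homEquiv X N f

theorem leftCurry_ev {M N : D} {X : C} (f : X ⊙ₗ M ⟶ N) :
    leftCurry f ⊵ₗ M ≫ leftEv C M N = f := by
  have h := ((leftHomAdj C M).homEquiv X N).symm_apply_apply f
  rw [Adjunction.homEquiv_counit] at h
  exact h

theorem left_hom_ext {M N : D} {X : C} {f g : X ⟶ (leftHom C M).obj N}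
    (h : f ⊵ₗ M ≫ leftEv C M N = g ⊵ₗ M ≫ leftEv C M N) : f = g := by
  apply ((leftHomAdj C M).homEquiv X N).symm.injective
  rw [Adjunction.homEquiv_counit, Adjunction.homEquiv_counit]
  exact h

variable (C) in
/-- The internal End of an object of a closed left `C`-module category. -/
noncomputable def leftEnd (M : D) : C := (leftHom C M).obj M

variable (C) in
/-- The evaluation `End(M) ▷ M ⟶ M`. -/
noncomputable def leftEndEv (M : D) : leftEnd C M ⊙ₗ M ⟶ M := leftEv C M M

variable (C) in
/-- The unit of the internal End, corresponding to `1 ▷ M ≅ M`. -/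
noncomputable def leftEndOne (M : D) : 𝟙_ C ⟶ leftEnd C M := leftCurry (λₗ M).hom

variable (C) in
/-- The product of the internal End `E`, corresponding to
`(E ⊗ E) ▷ M ≅ E ▷ (E ▷ M) ⟶ E ▷ M ⟶ M`. -/
noncomputable def leftEndMul (M : D) : leftEnd C M ⊗ leftEnd C M ⟶ leftEnd C M :=
  leftCurry ((αₗ (leftEnd C M) (leftEnd C M) M).hom ≫
    leftEnd C M ⊴ₗ leftEndEv C M ≫ leftEndEv C M)

theorem leftEndOne_ev (M : D) : leftEndOne C M ⊵ₗ M ≫ leftEndEv C M = (λₗ M).hom :=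
  leftCurry_ev _

theorem leftEndMul_ev (M : D) : leftEndMul C M ⊵ₗ M ≫ leftEndEv C M =
    (αₗ (leftEnd C M) (leftEnd C M) M).hom ≫ leftEnd C M ⊴ₗ leftEndEv C M ≫ leftEndEv C M :=
  leftCurry_ev _

theorem leftEnd_ext {M : D} {X : C} {f g : X ⟶ leftEnd C M}
    (h : f ⊵ₗ M ≫ leftEndEv C M = g ⊵ₗ M ≫ leftEndEv C M) : f = g :=
  left_hom_ext h

/-- The algebra structure of the internal End. -/
noncomputable instance (M : D) : MonObj (leftEnd C M) where
  one := leftEndOne C M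
  mul := leftEndMul C M
  one_mul := by
    apply leftEnd_ext
    rw [comp_actionHomLeft, Category.assoc, leftEndMul_ev, whiskerRight_actionHomLeft,
      Category.assoc, Category.assoc, Iso.inv_hom_id_assoc, ← action_exchange_assoc,
      leftEndOne_ev, leftUnitor_actionHom, ← actionUnitIso_hom_naturality, Category.assoc]
  mul_one := by
    apply leftEnd_ext
    rw [comp_actionHomLeft, Category.assoc, leftEndMul_ev, whiskerLeft_actionHomLeft,
      Category.assoc, Category.assoc, Iso.inv_hom_id_assoc, ← actionHomRight_comp_assoc,
      leftEndOne_ev, rightUnitor_actionHom, Category.assoc]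
  mul_assoc := by
    have h := congrArg (fun f => leftEnd C M ⊴ₗ f) (leftEndMul_ev (C := C) M)
    simp only [actionHomRight_comp] at h
    apply leftEnd_ext
    rw [comp_actionHomLeft, comp_actionHomLeft, comp_actionHomLeft, Category.assoc,
      Category.assoc, Category.assoc, leftEndMul_ev, whiskerRight_actionHomLeft,
      Category.assoc, Category.assoc, Iso.inv_hom_id_assoc, ← action_exchange_assoc,
      leftEndMul_ev, tensor_actionHomRight, Category.assoc, Category.assoc,
      Iso.inv_hom_id_assoc, whiskerLeft_actionHomLeft, Category.assoc, Category.assoc,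
      Iso.inv_hom_id_assoc, reassoc_of% h, associator_actionHom_assoc]

end ClosedLeft

section ClosedRight

variable (C : Type u) [Category.{v} C] [MonoidalCategory C]
  (D : Type u₂) [Category.{v₂} D] [MonoidalRightAction C D]

/-- A right `C`-module category is closed if every functor `X ↦ N ◁ X` has a right adjoint. -/
class IsClosedRight : Prop where
  isLeftAdjoint (N : D) : (MonoidalRightAction.actionLeft C N).IsLeftAdjoint

attribute [instance] IsClosedRight.isLeftAdjoint

variable {D} [IsClosedRight C D]

open MonoidalRightAction

/-- The internal Hom functor of an object of a closed right `C`-module category. -/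
noncomputable def rightHom (N : D) : D ⥤ C := (actionLeft C N).rightAdjoint

/-- The adjunction defining the internal Hom. -/
noncomputable def rightHomAdj (N : D) : actionLeft C N ⊣ rightHom C N :=
  Adjunction.ofIsLeftAdjoint _

/-- The evaluation `N ◁ Hom(N, N') ⟶ N'`. -/
noncomputable def rightEv (N N' : D) : N ⊙ᵣ ((rightHom C N).obj N') ⟶ N' :=
  (rightHomAdj C N).counit.app N'

variable {C}

/-- The morphism `X ⟶ Hom(N, N')` corresponding to `N ◁ X ⟶ N'`. -/
noncomputable def rightCurry {N N' : D} {X : C} (f : N ⊙ᵣ X ⟶ N') : X ⟶ (rightHom C N).obj N' :=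
  (rightHomAdj C N).homEquiv X N' f

theorem rightCurry_ev {N N' : D} {X : C} (f : N ⊙ᵣ X ⟶ N') :
    N ⊴ᵣ rightCurry f ≫ rightEv C N N' = f := by
  have h := ((rightHomAdj C N).homEquiv X N').symm_apply_apply f
  rw [Adjunction.homEquiv_counit] at h
  exact h

theorem right_hom_ext {N N' : D} {X : C} {f g : X ⟶ (rightHom C N).obj N'}
    (h : N ⊴ᵣ f ≫ rightEv C N N' = N ⊴ᵣ g ≫ rightEv C N N') : f = g := by
  apply ((rightHomAdj C N).homEquiv X N').symm.injective
  rw [Adjunction.homEquiv_counit, Adjunction.homEquiv_counit]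
  exact h

variable (C) in
/-- The internal End of an object of a closed right `C`-module category. -/
noncomputable def rightEnd (N : D) : C := (rightHom C N).obj N

variable (C) in
/-- The evaluation `N ◁ End(N) ⟶ N`. -/
noncomputable def rightEndEv (N : D) : N ⊙ᵣ rightEnd C N ⟶ N := rightEv C N N

variable (C) in
/-- The unit of the internal End, corresponding to `N ◁ 1 ≅ N`. -/
noncomputable def rightEndOne (N : D) : 𝟙_ C ⟶ rightEnd C N := rightCurry (ρᵣ N).hom

variable (C) in
/-- The product of the internal End `E`, corresponding to
`N ◁ (E ⊗ E) ≅ (N ◁ E) ◁ E ⟶ N ◁ E ⟶ N`. -/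
noncomputable def rightEndMul (N : D) : rightEnd C N ⊗ rightEnd C N ⟶ rightEnd C N :=
  rightCurry ((αᵣ N (rightEnd C N) (rightEnd C N)).hom ≫
    rightEndEv C N ⊵ᵣ rightEnd C N ≫ rightEndEv C N)

theorem rightEndOne_ev (N : D) : N ⊴ᵣ rightEndOne C N ≫ rightEndEv C N = (ρᵣ N).hom :=
  rightCurry_ev _

theorem rightEndMul_ev (N : D) : N ⊴ᵣ rightEndMul C N ≫ rightEndEv C N =
    (αᵣ N (rightEnd C N) (rightEnd C N)).hom ≫
      rightEndEv C N ⊵ᵣ rightEnd C N ≫ rightEndEv C N :=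
  rightCurry_ev _

theorem rightEnd_ext {N : D} {X : C} {f g : X ⟶ rightEnd C N}
    (h : N ⊴ᵣ f ≫ rightEndEv C N = N ⊴ᵣ g ≫ rightEndEv C N) : f = g :=
  right_hom_ext h

/-- The algebra structure of the internal End. -/
noncomputable instance (N : D) : MonObj (rightEnd C N) where
  one := rightEndOne C N
  mul := rightEndMul C N
  one_mul := by
    apply rightEnd_ext
    rw [actionHomRight_comp, Category.assoc, rightEndMul_ev, actionHomRight_whiskerRight,
      Category.assoc, Category.assoc, Iso.inv_hom_id_assoc, ← comp_actionHomLeft_assoc,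
      rightEndOne_ev, actionHom_leftUnitor, Category.assoc]
  mul_one := by
    apply rightEnd_ext
    rw [actionHomRight_comp, Category.assoc, rightEndMul_ev, whiskerRight_actionHomLeft,
      Category.assoc, Category.assoc, Iso.inv_hom_id_assoc, action_exchange_assoc,
      rightEndOne_ev, actionHom_rightUnitor, ← actionUnitIso_hom_naturality, Category.assoc]
  mul_assoc := by
    have h := congrArg (fun f => f ⊵ᵣ rightEnd C N) (rightEndMul_ev (C := C) N)
    simp only [comp_actionHomLeft] at h
    apply rightEnd_ext
    rw [actionHomRight_comp, actionHomRight_comp, actionHomRight_comp, Category.assoc,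
      Category.assoc, Category.assoc, rightEndMul_ev, actionHomRight_whiskerRight,
      Category.assoc, Category.assoc, Iso.inv_hom_id_assoc, reassoc_of% h,
      whiskerRight_actionHomLeft, Category.assoc, Category.assoc, Iso.inv_hom_id_assoc,
      action_exchange_assoc, rightEndMul_ev, actionHomLeft_tensor, Category.assoc, Category.assoc,
      Iso.inv_hom_id_assoc, actionHom_associator_assoc]

end ClosedRight

/-! ### Modules over an algebra in a rigid category form closed module categories -/

section Universal

variable {C : Type u} [Category.{v} C]

theorem isLeftAdjoint_of_universal {D : Type u₂} [Category.{v₂} D] (F : C ⥤ D)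
    (h : ∀ N : D, ∃ (H : C) (ev : F.obj H ⟶ N), ∀ (X : C) (f : F.obj X ⟶ N),
      ∃! g : X ⟶ H, F.map g ≫ ev = f) : F.IsLeftAdjoint := by
  choose H ev u using h
  choose g hg hu using u
  exact (Adjunction.adjunctionOfEquivRight (F := F) (G_obj := H)
    (fun X N => (⟨fun f => g N X f, fun k => F.map k ≫ ev N, fun f => hg N X f,
      fun k => (hu N X _ k rfl).symm⟩ : (F.obj X ⟶ N) ≃ (X ⟶ H N)))
    (fun X' X N k f => (hu N X' _ _ (by
      simp only [Functor.map_comp, Category.assoc]; erw [hg N X f])).symm)).isLeftAdjoint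

theorem exists_universal [HasEqualizers C] (T T' : C ⥤ C) [T.IsLeftAdjoint] [T'.IsLeftAdjoint]
    (N : C) (Φ Ψ : ∀ X, (T.obj X ⟶ N) → (T'.obj X ⟶ N))
    (hΦ : ∀ {X Y : C} (g : X ⟶ Y) (f : T.obj Y ⟶ N), Φ X (T.map g ≫ f) = T'.map g ≫ Φ Y f)
    (hΨ : ∀ {X Y : C} (g : X ⟶ Y) (f : T.obj Y ⟶ N), Ψ X (T.map g ≫ f) = T'.map g ≫ Ψ Y f) :
    ∃ (H : C) (ev : T.obj H ⟶ N), Φ H ev = Ψ H ev ∧ ∀ (X : C) (f : T.obj X ⟶ N),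
      Φ X f = Ψ X f → ∃! g : X ⟶ H, T.map g ≫ ev = f := by
  let adj := Adjunction.ofIsLeftAdjoint T
  let adj' := Adjunction.ofIsLeftAdjoint T'
  let ε := adj.counit.app N
  let a := adj'.homEquiv _ _ (Φ _ ε)
  let b := adj'.homEquiv _ _ (Ψ _ ε)
  have key {X : C} (g : X ⟶ T.rightAdjoint.obj N) :
      g ≫ a = g ≫ b ↔ Φ X (T.map g ≫ ε) = Ψ X (T.map g ≫ ε) := by
    rw [hΦ, hΨ, ← (adj'.homEquiv _ _).apply_eq_iff_eq, adj'.homEquiv_naturality_left,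
      adj'.homEquiv_naturality_left]
  have surj {X : C} (f : T.obj X ⟶ N) : T.map (adj.homEquiv _ _ f) ≫ ε = f := by
    have h := (adj.homEquiv X N).symm_apply_apply f
    rwa [adj.homEquiv_counit] at h
  refine ⟨equalizer a b, T.map (equalizer.ι a b) ≫ ε, (key _).1 (equalizer.condition a b), ?_⟩
  intro X f hf
  refine ⟨equalizer.lift (adj.homEquiv _ _ f) ((key _).2 (by rw [surj]; exact hf)), ?_, ?_⟩
  · change T.map _ ≫ T.map _ ≫ ε = f
    rw [← T.map_comp_assoc, equalizer.lift_ι, surj]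
  · intro g hg
    apply equalizer.hom_ext
    rw [equalizer.lift_ι, ← (adj.homEquiv _ _).symm.apply_eq_iff_eq, Equiv.symm_apply_apply,
      adj.homEquiv_counit, T.map_comp, Category.assoc]
    exact hg

end Universal

section ModulesClosed

variable {C : Type u} [Category.{v} C] [MonoidalCategory C] {A : C} [MonObj A]

instance [HasEqualizers C] [RightRigidCategory C] : IsClosedLeft C (RightMod A) where
  isLeftAdjoint M := isLeftAdjoint_of_universal _ (fun N => by
    have h (X : C) : (tensorRight X).IsLeftAdjoint := (tensorRightAdjunction X (Xᘁ)).isLeftAdjoint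
    obtain ⟨H, ev, hev, hu⟩ := exists_universal (tensorRight M.X) (tensorRight (M.X ⊗ A)) N.X
      (fun X f => (α_ X M.X A).inv ≫ f ▷ A ≫ N.act) (fun X f => X ◁ M.act ≫ f)
      (fun g f => by simp) (fun g f => by
        change _ ◁ M.act ≫ g ▷ M.X ≫ f = g ▷ (M.X ⊗ A) ≫ _ ◁ M.act ≫ f
        rw [whisker_exchange_assoc])
    have key {X : C} (f : X ⊗ M.X ⟶ N.X) :
        (α_ X M.X A).inv ≫ f ▷ A ≫ N.act = X ◁ M.act ≫ f ↔
          ((α_ X M.X A).hom ≫ X ◁ M.act) ≫ f = f ▷ A ≫ N.act := by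
      rw [Iso.inv_comp_eq, Category.assoc, eq_comm]
    refine ⟨H, RightMod.Hom.mk ev ((key ev).1 hev), fun X f => ?_⟩
    obtain ⟨g, hg, hg'⟩ := hu X f.hom ((key _).2 f.act_hom)
    exact ⟨g, RightMod.hom_ext _ _ hg, fun k hk => hg' k (congrArg RightMod.Hom.hom hk)⟩)

instance [HasEqualizers C] [LeftRigidCategory C] : IsClosedRight C (Mod C A) where
  isLeftAdjoint M := isLeftAdjoint_of_universal _ (fun N => by
    have h (X : C) : (tensorLeft X).IsLeftAdjoint := (tensorLeftAdjunction (ᘁX) X).isLeftAdjoint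
    obtain ⟨H, ev, hev, hu⟩ := exists_universal (tensorLeft M.X) (tensorLeft (A ⊗ M.X)) N.X
      (fun X f => (α_ A M.X X).hom ≫ A ◁ f ≫ LeftMod.act N) (fun X f => LeftMod.act M ▷ X ≫ f)
      (fun g f => by simp) (fun g f => by
        change LeftMod.act M ▷ _ ≫ M.X ◁ g ≫ f = (A ⊗ M.X) ◁ g ≫ LeftMod.act M ▷ _ ≫ f
        rw [whisker_exchange_assoc])
    have key {X : C} (f : M.X ⊗ X ⟶ N.X) :
        (α_ A M.X X).hom ≫ A ◁ f ≫ LeftMod.act N = LeftMod.act M ▷ X ≫ f ↔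
          ((α_ A M.X X).inv ≫ LeftMod.act M ▷ X) ≫ f = A ◁ f ≫ LeftMod.act N := by
      rw [Category.assoc, Iso.inv_comp_eq, eq_comm]
    refine ⟨H, LeftMod.mkHom (M := LeftMod.tensor M H) ev ((key ev).1 hev), fun X f => ?_⟩
    obtain ⟨g, hg, hg'⟩ := hu X f.hom ((key _).2 (LeftMod.hom_act f))
    exact ⟨g, Mod.hom_ext _ _ hg, fun k hk => hg' k (congrArg Mod.Hom.hom hk)⟩)

end ModulesClosed

/-! ### Simplistic division algebras -/

section Simplistic

variable {C : Type u} [Category.{v} C] [Preadditive C] [MonoidalCategory C] [MonoidalPreadditive C]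

/-- A nonzero algebra whose regular right module is simple. -/
def IsRightSimplistic (B : C) [MonObj B] : Prop :=
  ¬ IsZero B ∧ Simple (RightMod.regular B)

/-- A nonzero algebra whose regular left module is simple. -/
def IsLeftSimplistic (B : C) [MonObj B] : Prop :=
  ¬ IsZero B ∧ Simple (Mod.regular B)

end Simplistic

/-! ### Semisimple, multifusion, and indecomposable module categories -/

/-- Every object is a finite direct sum of simple objects. -/
def IsSemisimpleCat (D : Type u) [Category.{v} D] [HasZeroMorphisms D] : Prop :=
  ∀ X : D, ∃ (n : ℕ) (S : Fin n → D) (b : Bicone S),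
    (∀ i, Simple (S i)) ∧ Nonempty b.IsBilimit ∧ Nonempty (b.pt ≅ X)

/-- Multifusion categories over `k`: the abelian, `k`-linear monoidal and rigid structures are
the instance arguments; the fields say that the underlying category is finite and semisimple. -/
class IsMultifusion (k : Type w) [Field k] (C : Type u) [Category.{v} C] [Abelian C] [Linear k C]
    [MonoidalCategory C] [MonoidalPreadditive C] [MonoidalLinear k C] [RigidCategory C] :
    Prop where
  finite_hom (X Y : C) : Module.Finite k (X ⟶ Y)
  /-- Every object has finite length, i.e. is both Noetherian and Artinian. -/
  noetherian (X : C) : IsNoetherianObject X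
  artinian (X : C) : IsArtinianObject X
  enoughProjectives : EnoughProjectives C
  finite_simples : ∃ (n : ℕ) (S : Fin n → C), ∀ X : C, Simple X → ∃ i, Nonempty (X ≅ S i)
  semisimple : IsSemisimpleCat C

/-- The category `D` is the direct sum of its full subcategories `P` and `Q`: there are no
nonzero morphisms between them, and every object is a direct sum of an object of `P` and an
object of `Q`. -/
structure IsDirectSum {D : Type u} [Category.{v} D] [HasZeroMorphisms D]
    (P Q : ObjectProperty D) : Prop where
  isoClosed_left : P.IsClosedUnderIsomorphisms
  isoClosed_right : Q.IsClosedUnderIsomorphisms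
  hom_eq_zero {X Y : D} (hX : P X) (hY : Q Y) (f : X ⟶ Y) : f = 0
  hom_eq_zero' {X Y : D} (hX : P X) (hY : Q Y) (f : Y ⟶ X) : f = 0
  exists_sum (Z : D) : ∃ (X Y : D) (b : BinaryBicone X Y),
    P X ∧ Q Y ∧ Nonempty b.IsBilimit ∧ Nonempty (b.pt ≅ Z)

/-- A left `C`-module category is indecomposable if it is not the direct sum of two nonzero
module subcategories. -/
def IsIndecomposableLeft (C : Type u) [Category.{v} C] [MonoidalCategory C]
    (D : Type u₂) [Category.{v₂} D] [HasZeroMorphisms D] [MonoidalLeftAction C D] : Prop :=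
  ∀ P Q : ObjectProperty D, IsDirectSum P Q →
    (∀ (c : C) (X : D), P X → P (MonoidalLeftAction.actionObj c X)) →
    (∀ (c : C) (X : D), Q X → Q (MonoidalLeftAction.actionObj c X)) →
    (∀ X, P X → IsZero X) ∨ (∀ X, Q X → IsZero X)

/-- A right `C`-module category is indecomposable if it is not the direct sum of two nonzero
module subcategories. -/
def IsIndecomposableRight (C : Type u) [Category.{v} C] [MonoidalCategory C]
    (D : Type u₂) [Category.{v₂} D] [HasZeroMorphisms D] [MonoidalRightAction C D] : Prop :=
  ∀ P Q : ObjectProperty D, IsDirectSum P Q →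
    (∀ (X : D) (c : C), P X → P (MonoidalRightAction.actionObj X c)) →
    (∀ (X : D) (c : C), Q X → Q (MonoidalRightAction.actionObj X c)) →
    (∀ X, P X → IsZero X) ∨ (∀ X, Q X → IsZero X)

/-- The hypotheses on a left module category: semisimple, nonzero, indecomposable. -/
structure OstrikLeft (C : Type u) [Category.{v} C] [MonoidalCategory C]
    (D : Type u₂) [Category.{v₂} D] [HasZeroMorphisms D] [MonoidalLeftAction C D] : Prop where
  semisimple : IsSemisimpleCat D
  nonzero : ∃ X : D, ¬ IsZero X
  indecomposable : IsIndecomposableLeft C D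

/-- The hypotheses on a right module category: semisimple, nonzero, indecomposable. -/
structure OstrikRight (C : Type u) [Category.{v} C] [MonoidalCategory C]
    (D : Type u₂) [Category.{v₂} D] [HasZeroMorphisms D] [MonoidalRightAction C D] : Prop where
  semisimple : IsSemisimpleCat D
  nonzero : ∃ X : D, ¬ IsZero X
  indecomposable : IsIndecomposableRight C D

end DivAlg

/-!
Let `E` be the internal End of `M`. Postcomposition embeds the endomorphism ring of `M` in that of
the regular `E`-module. If the regular module is simple, the latter is a division ring by Schur's
lemma, so `M` has no nontrivial idempotents; in a semisimple category this makes `M` simple.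

Conversely, let `M` be simple, and let `I ⟶ E` be a nonzero right ideal. The evaluation
`I ▷ M ⟶ E ▷ M ⟶ M` corresponds to `I ⟶ E` by adjunction, so it is nonzero, and by semisimplicity it
has a section `M ⟶ I ▷ M`. Since `I` has a dual, the section comes from an element `1 ⟶ I ⊗ E`, and
the action `I ⊗ E ⟶ I` turns this element into a preimage of the unit of `E`. Hence `I = E`.
-/

namespace DivAlg

/-! ### Semisimple categories -/

section Semisimple

variable {D : Type u} [Category.{v} D]

theorem IsSemisimpleCat.exists_retract_comp_ne_zero [HasZeroMorphisms D] (hD : IsSemisimpleCat D)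
    {X M : D} {p : X ⟶ M} (hp : p ≠ 0) :
    ∃ (S : D) (r : Retract S X), Simple S ∧ r.i ≫ p ≠ 0 := by
  obtain ⟨n, S, b, hS, ⟨hb⟩, ⟨e⟩⟩ := hD X
  obtain ⟨i, hi⟩ : ∃ i, b.ι i ≫ e.hom ≫ p ≠ 0 := by
    by_contra! h
    apply hp
    rw [← cancel_epi e.hom, comp_zero]
    exact hb.isColimit.hom_ext (fun ⟨j⟩ => by simpa using h j)
  exact ⟨S i, ⟨b.ι i ≫ e.hom, e.inv ≫ b.π i, by simp⟩, hS i, by simpa using hi⟩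

theorem IsSemisimpleCat.isSplitEpi_of_simple [Preadditive D] [HasKernels D]
    (hD : IsSemisimpleCat D) {X M : D} [Simple M] {p : X ⟶ M} (hp : p ≠ 0) : IsSplitEpi p := by
  obtain ⟨S, r, hS, hrp⟩ := hD.exists_retract_comp_ne_zero hp
  have := isIso_of_hom_simple hrp
  exact IsSplitEpi.mk' ⟨inv (r.i ≫ p) ≫ r.i, by simp⟩

theorem IsSemisimpleCat.simple_of_idempotents [HasZeroMorphisms D] (hD : IsSemisimpleCat D)
    {M : D} (hM : ¬ IsZero M) (h : ∀ e : M ⟶ M, e ≫ e = e → e = 0 ∨ e = 𝟙 M) : Simple M := by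
  obtain ⟨S, r, hS, hr⟩ := hD.exists_retract_comp_ne_zero (mt (IsZero.iff_id_eq_zero M).2 hM)
  rw [Category.comp_id] at hr
  rcases h (r.r ≫ r.i) (by simp) with h0 | h1
  · exact absurd (by simpa using r.i ≫= h0) hr
  · exact Simple.of_iso ⟨r.r, r.i, h1, r.retract⟩

end Semisimple

/-! ### Kernels of morphisms of modules -/

section Kernels

variable {C : Type u} [Category.{v} C] [MonoidalCategory C] {A : C} [MonObj A]

/-- The submodule of a right module carried by a subobject that is stable under the action. -/
def RightMod.ofMono (M : RightMod A) {K : C} (j : K ⟶ M.X) [Mono j] (a : K ⊗ A ⟶ K)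
    (ha : a ≫ j = j ▷ A ≫ M.act) : RightMod A where
  X := K
  act := a
  act_one := by
    rw [← cancel_mono j, Category.assoc, ha, whisker_exchange_assoc, M.act_one,
      rightUnitor_naturality]
  act_mul := by
    rw [← cancel_mono j]
    simp only [Category.assoc, ha]
    rw [whisker_exchange_assoc, M.act_mul, ← comp_whiskerRight_assoc, ha]
    simp

/-- The submodule of a left module carried by a subobject that is stable under the action. -/
def LeftMod.ofMono (M : Mod C A) {K : C} (j : K ⟶ M.X) [Mono j] (a : A ⊗ K ⟶ K)
    (ha : a ≫ j = A ◁ j ≫ act M) : Mod C A where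
  X := K
  mod :=
    { smul := a
      one_smul := by
        change (MonObj.one : 𝟙_ C ⟶ A) ▷ K ≫ a = (λ_ K).hom
        rw [← cancel_mono j, Category.assoc, ha, ← whisker_exchange_assoc, one_act,
          leftUnitor_naturality]
      mul_smul := by
        change (MonObj.mul : A ⊗ A ⟶ A) ▷ K ≫ a = (α_ A A K).hom ≫ A ◁ a ≫ a
        rw [← cancel_mono j]
        simp only [Category.assoc, ha]
        rw [← whisker_exchange_assoc, mul_act, ← MonoidalCategory.whiskerLeft_comp_assoc, ha]
        simp }

theorem RightMod.mono_of_mono_hom {M N : RightMod A} (f : M ⟶ N) [Mono f.hom] : Mono f where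
  right_cancellation g h w :=
    RightMod.hom_ext g h ((cancel_mono f.hom).1 (congrArg RightMod.Hom.hom w))

theorem LeftMod.mono_of_mono_hom {M N : Mod C A} (f : M ⟶ N) [Mono f.hom] : Mono f where
  right_cancellation g h w := Mod.hom_ext g h ((cancel_mono f.hom).1 (congrArg Mod.Hom.hom w))

/-- The factorization of `g` through a submodule `i` induced by a factorization in `C`. -/
def RightMod.liftMono {I L M : RightMod A} (i : I ⟶ M) [Mono i.hom] (g : L ⟶ M) (k : L.X ⟶ I.X)
    (hk : k ≫ i.hom = g.hom) : L ⟶ I where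
  hom := k
  act_hom := by
    rw [← cancel_mono i.hom, Category.assoc, Category.assoc, hk, i.act_hom, g.act_hom,
      ← comp_whiskerRight_assoc, hk]

/-- The factorization of `g` through a submodule `i` induced by a factorization in `C`. -/
def LeftMod.liftMono {I L M : Mod C A} (i : I ⟶ M) [Mono i.hom] (g : L ⟶ M) (k : L.X ⟶ I.X)
    (hk : k ≫ i.hom = g.hom) : L ⟶ I :=
  mkHom k (by
    rw [← cancel_mono i.hom, Category.assoc, Category.assoc, hk, hom_act, hom_act,
      ← MonoidalCategory.whiskerLeft_comp_assoc, hk])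

variable [Preadditive C] [MonoidalPreadditive C] [HasKernels C]

/-- The kernel of a morphism of right modules, carried by the kernel in `C`. -/
noncomputable def RightMod.ker {M N : RightMod A} (f : M ⟶ N) : RightMod A :=
  M.ofMono (kernel.ι f.hom)
    (kernel.lift f.hom (kernel.ι f.hom ▷ A ≫ M.act) (by
      rw [Category.assoc, f.act_hom, ← comp_whiskerRight_assoc, kernel.condition,
        MonoidalPreadditive.zero_whiskerRight, zero_comp]))
    (kernel.lift_ι _ _ _)

/-- The inclusion of the kernel of a morphism of right modules. -/
noncomputable def RightMod.kerι {M N : RightMod A} (f : M ⟶ N) : RightMod.ker f ⟶ M where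
  hom := kernel.ι f.hom
  act_hom := kernel.lift_ι _ _ _

instance {M N : RightMod A} (f : M ⟶ N) : Mono (RightMod.kerι f).hom :=
  inferInstanceAs (Mono (kernel.ι f.hom))

instance : HasKernels (RightMod A) where
  has_limit f :=
    have := RightMod.mono_of_mono_hom (RightMod.kerι f)
    HasLimit.mk ⟨KernelFork.ofι (RightMod.kerι f) (RightMod.hom_ext _ _ (kernel.condition f.hom)),
      KernelFork.IsLimit.ofι' _ _ (fun g hg =>
        ⟨RightMod.liftMono (RightMod.kerι f) g
            (kernel.lift f.hom g.hom (congrArg RightMod.Hom.hom hg)) (kernel.lift_ι _ _ _),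
          RightMod.hom_ext _ _ (kernel.lift_ι _ _ _)⟩)⟩

/-- The kernel of a morphism of left modules, carried by the kernel in `C`. -/
noncomputable def LeftMod.ker {M N : Mod C A} (f : M ⟶ N) : Mod C A :=
  LeftMod.ofMono M (kernel.ι f.hom)
    (kernel.lift f.hom (A ◁ kernel.ι f.hom ≫ act M) (by
      rw [Category.assoc, hom_act, ← MonoidalCategory.whiskerLeft_comp_assoc, kernel.condition,
        MonoidalPreadditive.whiskerLeft_zero, zero_comp]))
    (kernel.lift_ι _ _ _)

/-- The inclusion of the kernel of a morphism of left modules. -/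
noncomputable def LeftMod.kerι {M N : Mod C A} (f : M ⟶ N) : LeftMod.ker f ⟶ M :=
  mkHom (M := LeftMod.ker f) (kernel.ι f.hom) (kernel.lift_ι _ _ _)

instance {M N : Mod C A} (f : M ⟶ N) : Mono (LeftMod.kerι f).hom :=
  inferInstanceAs (Mono (kernel.ι f.hom))

instance : HasKernels (Mod C A) where
  has_limit f :=
    have := LeftMod.mono_of_mono_hom (LeftMod.kerι f)
    HasLimit.mk ⟨KernelFork.ofι (LeftMod.kerι f) (Mod.hom_ext _ _ (kernel.condition f.hom)),
      KernelFork.IsLimit.ofι' _ _ (fun g hg =>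
        ⟨LeftMod.liftMono (LeftMod.kerι f) g
            (kernel.lift f.hom g.hom (congrArg Mod.Hom.hom hg)) (kernel.lift_ι _ _ _),
          Mod.hom_ext _ _ (kernel.lift_ι _ _ _)⟩)⟩

end Kernels

/-! ### The regular module -/

section RegularModules

variable {C : Type u} [Category.{v} C] [MonoidalCategory C] {B : C} [MonObj B]

/-- The morphism of right modules `B ⟶ I` given by multiplying the element `u` of `I` by `B`. -/
def RightMod.ofElement (I : RightMod B) (u : 𝟙_ C ⟶ I.X) : RightMod.regular B ⟶ I where
  hom := (λ_ B).inv ≫ u ▷ B ≫ I.act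
  act_hom := by
    change (MonObj.mul : B ⊗ B ⟶ B) ≫ (λ_ B).inv ≫ u ▷ B ≫ I.act =
      ((λ_ B).inv ≫ u ▷ B ≫ I.act) ▷ B ≫ I.act
    rw [leftUnitor_inv_naturality_assoc, whisker_exchange_assoc, I.act_mul]
    simp

theorem RightMod.ofElement_comp {I : RightMod B} (i : I ⟶ RightMod.regular B) {u : 𝟙_ C ⟶ I.X}
    (hu : u ≫ i.hom = (MonObj.one : 𝟙_ C ⟶ B)) : I.ofElement u ≫ i = 𝟙 _ := by
  suffices ∀ j : I.X ⟶ B, I.act ≫ j = j ▷ B ≫ (MonObj.mul : B ⊗ B ⟶ B) → u ≫ j = MonObj.one →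
      ((λ_ B).inv ≫ u ▷ B ≫ I.act) ≫ j = 𝟙 B from
    RightMod.hom_ext _ _ (this i.hom i.act_hom hu)
  intro j hj hu
  rw [Category.assoc, Category.assoc, hj, ← comp_whiskerRight_assoc, hu, MonObj.one_mul,
    Iso.inv_hom_id]

/-- The morphism of left modules `B ⟶ I` given by multiplying the element `u` of `I` by `B`. -/
def LeftMod.ofElement (I : Mod C B) (u : 𝟙_ C ⟶ I.X) : Mod.regular B ⟶ I :=
  mkHom (M := Mod.regular B) ((ρ_ B).inv ≫ B ◁ u ≫ act I) (by
    change (MonObj.mul : B ⊗ B ⟶ B) ≫ (ρ_ B).inv ≫ B ◁ u ≫ act I =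
      B ◁ ((ρ_ B).inv ≫ B ◁ u ≫ act I) ≫ act I
    rw [rightUnitor_inv_naturality_assoc, ← whisker_exchange_assoc, mul_act]
    simp)

theorem LeftMod.ofElement_comp {I : Mod C B} (i : I ⟶ Mod.regular B) {u : 𝟙_ C ⟶ I.X}
    (hu : u ≫ i.hom = (MonObj.one : 𝟙_ C ⟶ B)) : LeftMod.ofElement I u ≫ i = 𝟙 _ := by
  suffices ∀ j : I.X ⟶ B, act I ≫ j = B ◁ j ≫ (MonObj.mul : B ⊗ B ⟶ B) → u ≫ j = MonObj.one →
      ((ρ_ B).inv ≫ B ◁ u ≫ act I) ≫ j = 𝟙 B from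
    Mod.hom_ext _ _ (this i.hom (hom_act i) hu)
  intro j hj hu
  rw [Category.assoc, Category.assoc, hj, ← MonoidalCategory.whiskerLeft_comp_assoc, hu,
    MonObj.mul_one, Iso.inv_hom_id]

variable [Preadditive C] [MonoidalPreadditive C]

theorem isRightSimplistic_of_exists_unit (hB : ¬ IsZero B)
    (h : ∀ (I : RightMod B) (i : I ⟶ RightMod.regular B), i ≠ 0 →
      ∃ u : 𝟙_ C ⟶ I.X, u ≫ i.hom = (MonObj.one : 𝟙_ C ⟶ B)) : IsRightSimplistic B := by
  refine ⟨hB, ⟨fun {I} i _ => ⟨fun _ hi => ?_, fun hi => ?_⟩⟩⟩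
  · have hid : 𝟙 (RightMod.regular B) = 0 :=
      (IsIso.inv_hom_id i).symm.trans ((inv i ≫= hi).trans comp_zero)
    exact hB ((IsZero.iff_id_eq_zero B).2 (congrArg RightMod.Hom.hom hid))
  · obtain ⟨u, hu⟩ := h I i hi
    have := IsSplitEpi.mk' ⟨I.ofElement u, RightMod.ofElement_comp i hu⟩
    exact isIso_of_mono_of_isSplitEpi i

theorem isLeftSimplistic_of_exists_unit (hB : ¬ IsZero B)
    (h : ∀ (I : Mod C B) (i : I ⟶ Mod.regular B), i ≠ 0 →
      ∃ u : 𝟙_ C ⟶ I.X, u ≫ i.hom = (MonObj.one : 𝟙_ C ⟶ B)) : IsLeftSimplistic B := by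
  refine ⟨hB, ⟨fun {I} i _ => ⟨fun _ hi => ?_, fun hi => ?_⟩⟩⟩
  · have hid : 𝟙 (Mod.regular B) = 0 :=
      (IsIso.inv_hom_id i).symm.trans ((inv i ≫= hi).trans comp_zero)
    exact hB ((IsZero.iff_id_eq_zero B).2 (congrArg Mod.Hom.hom hid))
  · obtain ⟨u, hu⟩ := h I i hi
    have := IsSplitEpi.mk' ⟨LeftMod.ofElement I u, LeftMod.ofElement_comp i hu⟩
    exact isIso_of_mono_of_isSplitEpi i

end RegularModules

/-! ### Left module categories -/

section LeftModuleCategories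

open MonoidalLeftAction

variable {C : Type u} [Category.{v} C] [MonoidalCategory C]
  {D : Type u₂} [Category.{v₂} D] [MonoidalLeftAction C D]

theorem coevaluation_evaluation_action (X Y : C) [ExactPairing X Y] (M : D) :
    η_ X Y ⊵ₗ (X ⊙ₗ M) ≫ (αₗ X Y (X ⊙ₗ M)).hom ≫ X ⊴ₗ (αₗ Y X M).inv ≫ X ⊴ₗ ε_ X Y ⊵ₗ M ≫
      X ⊴ₗ (λₗ M).hom = (λₗ (X ⊙ₗ M)).hom := by
  have zigzag : η_ X Y ▷ X ≫ (α_ X Y X).hom ≫ X ◁ ε_ X Y ≫ (ρ_ X).hom = (λ_ X).hom := by simp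
  have zigzag_action := congrArg (fun f => f ⊵ₗ M) zigzag
  simp only [comp_actionHomLeft, leftUnitor_actionHom, rightUnitor_actionHom,
    whiskerLeft_actionHomLeft, whiskerRight_actionHomLeft, Category.assoc,
    Iso.inv_hom_id_assoc, cancel_epi] at zigzag_action
  have pentagon : (αₗ X Y (X ⊙ₗ M)).hom ≫ X ⊴ₗ (αₗ Y X M).inv =
      (αₗ (X ⊗ Y) X M).inv ≫ (α_ X Y X).hom ⊵ₗ M ≫ (αₗ X (Y ⊗ X) M).hom := by
    rw [Iso.eq_inv_comp, ← cancel_mono (X ⊴ₗ (αₗ Y X M).hom)]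
    simp only [Category.assoc, actionHomRight_inv_hom, Category.comp_id, associator_actionHom]
  rw [← zigzag_action, reassoc_of% pentagon]

/-- The transpose of `s` under the adjunction `Y ▷ - ⊣ X ▷ -` of an exact pairing `(X, Y)`. -/
def leftTranspose (X Y : C) [ExactPairing X Y] {M N : D} (s : M ⟶ X ⊙ₗ N) : Y ⊙ₗ M ⟶ N :=
  Y ⊴ₗ s ≫ (αₗ Y X N).inv ≫ ε_ X Y ⊵ₗ N ≫ (λₗ N).hom

theorem coevaluation_leftTranspose (X Y : C) [ExactPairing X Y] {M N : D} (s : M ⟶ X ⊙ₗ N) :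
    η_ X Y ⊵ₗ M ≫ (αₗ X Y M).hom ≫ X ⊴ₗ leftTranspose X Y s = (λₗ M).hom ≫ s := by
  have naturality : (αₗ X Y M).hom ≫ X ⊴ₗ Y ⊴ₗ s =
      (X ⊗ Y) ⊴ₗ s ≫ (αₗ X Y (X ⊙ₗ N)).hom := by
    rw [tensor_actionHomRight, Category.assoc, Category.assoc, Iso.inv_hom_id, Category.comp_id]
  simp only [leftTranspose, actionHomRight_comp]
  rw [reassoc_of% naturality, ← action_exchange_assoc, coevaluation_evaluation_action,
    actionUnitIso_hom_naturality]

variable [IsClosedLeft C D]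

/-- Half of the isomorphism `Hom(M, X ▷ N) ≅ X ⊗ Hom(M, N)`, which holds because `X` has a dual. -/
theorem exists_comp_leftEv_eq {X : C} [HasRightDual X] {M N : D} (s : M ⟶ X ⊙ₗ N) :
    ∃ σ : 𝟙_ C ⟶ X ⊗ (leftHom C M).obj N,
      σ ⊵ₗ M ≫ (αₗ X ((leftHom C M).obj N) M).hom ≫ X ⊴ₗ leftEv C M N = (λₗ M).hom ≫ s := by
  refine ⟨η_ X Xᘁ ≫ X ◁ leftCurry (leftTranspose X Xᘁ s), ?_⟩
  rw [comp_actionHomLeft, whiskerLeft_actionHomLeft]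
  simp only [Category.assoc, Iso.inv_hom_id_assoc]
  rw [← actionHomRight_comp, leftCurry_ev, coevaluation_leftTranspose]

theorem whiskerRight_leftEndMul_ev {M : D} {X : C} (j : X ⟶ leftEnd C M) :
    (j ▷ leftEnd C M ≫ leftEndMul C M) ⊵ₗ M ≫ leftEndEv C M =
      (αₗ X (leftEnd C M) M).hom ≫ X ⊴ₗ leftEndEv C M ≫ j ⊵ₗ M ≫ leftEndEv C M := by
  rw [comp_actionHomLeft, Category.assoc, leftEndMul_ev, whiskerRight_actionHomLeft,
    Category.assoc, Category.assoc, Iso.inv_hom_id_assoc, action_exchange_assoc]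

variable (C) in
/-- Postcomposition with an endomorphism of `M` on the internal End of `M`. -/
noncomputable def leftEndMap {M : D} (e : M ⟶ M) : leftEnd C M ⟶ leftEnd C M :=
  (leftHom C M).map e

theorem leftEndMap_ev {M : D} (e : M ⟶ M) :
    leftEndMap C e ⊵ₗ M ≫ leftEndEv C M = leftEndEv C M ≫ e :=
  (leftHomAdj C M).counit.naturality e

theorem leftEndMap_id (M : D) : leftEndMap C (𝟙 M) = 𝟙 (leftEnd C M) :=
  (leftHom C M).map_id M

theorem leftEndMap_comp {M : D} (e e' : M ⟶ M) :
    leftEndMap C (e ≫ e') = leftEndMap C e ≫ leftEndMap C e' :=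
  (leftHom C M).map_comp e e'

theorem leftEndMul_map {M : D} (e : M ⟶ M) :
    leftEndMul C M ≫ leftEndMap C e = leftEndMap C e ▷ leftEnd C M ≫ leftEndMul C M := by
  apply leftEnd_ext
  rw [whiskerRight_leftEndMul_ev, comp_actionHomLeft, Category.assoc, leftEndMap_ev,
    reassoc_of% leftEndMul_ev (C := C) M]

theorem leftEndMap_injective (M : D) :
    Function.Injective (leftEndMap C : (M ⟶ M) → (leftEnd C M ⟶ leftEnd C M)) := by
  intro e e' h
  have hev : leftEndEv C M ≫ e = leftEndEv C M ≫ e' := by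
    rw [← leftEndMap_ev, h, leftEndMap_ev]
  rw [← cancel_epi (λₗ M : 𝟙_ C ⊙ₗ M ≅ M).hom, ← leftEndOne_ev, Category.assoc, Category.assoc,
    hev]

theorem exists_unit_of_isSplitEpi_left {M : D} {X : C} [HasRightDual X]
    {a : X ⊗ leftEnd C M ⟶ X} {j : X ⟶ leftEnd C M}
    (hj : a ≫ j = j ▷ leftEnd C M ≫ leftEndMul C M)
    [IsSplitEpi (j ⊵ₗ M ≫ leftEndEv C M)] : ∃ u : 𝟙_ C ⟶ X, u ≫ j = leftEndOne C M := by
  obtain ⟨σ, hσ⟩ : ∃ σ : 𝟙_ C ⟶ X ⊗ leftEnd C M, σ ⊵ₗ M ≫ (αₗ X (leftEnd C M) M).hom ≫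
      X ⊴ₗ leftEndEv C M = (λₗ M).hom ≫ section_ (j ⊵ₗ M ≫ leftEndEv C M) :=
    exists_comp_leftEv_eq _
  refine ⟨σ ≫ a, leftEnd_ext ?_⟩
  rw [Category.assoc, hj, comp_actionHomLeft, Category.assoc, whiskerRight_leftEndMul_ev,
    reassoc_of% hσ, IsSplitEpi.id, Category.comp_id, leftEndOne_ev]

section

variable [HasZeroMorphisms C] [HasZeroMorphisms D]

theorem comp_leftEndEv_eq_zero_iff {M : D} {X : C} (j : X ⟶ leftEnd C M) :
    j ⊵ₗ M ≫ leftEndEv C M = 0 ↔ j = 0 := by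
  have zero_comp_ev : (0 : X ⟶ leftEnd C M) ⊵ₗ M ≫ leftEndEv C M = 0 := by
    rw [show (0 : X ⟶ leftEnd C M) ⊵ₗ M = 0 from (actionRight C M).map_zero _ _, zero_comp]
  exact ⟨fun h => leftEnd_ext (h.trans zero_comp_ev.symm), fun h => h ▸ zero_comp_ev⟩

theorem leftEndMap_zero (M : D) : leftEndMap C (0 : M ⟶ M) = 0 :=
  (comp_leftEndEv_eq_zero_iff _).1 (by rw [leftEndMap_ev, comp_zero])

theorem isZero_leftEnd_iff {M : D} : IsZero (leftEnd C M) ↔ IsZero M := by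
  rw [IsZero.iff_id_eq_zero, IsZero.iff_id_eq_zero, ← (leftEndMap_injective (C := C) M).eq_iff,
    leftEndMap_zero, leftEndMap_id]

end

section

variable [Preadditive C] [MonoidalPreadditive C] [Preadditive D]

variable (C) in
/-- The action of `End M` by postcomposition on the internal End of `M`, which commutes with right
multiplication. -/
noncomputable def leftEndPostcomp (M : D) :
    End M →*₀ End (RightMod.regular (leftEnd C M)) where
  toFun e := ⟨leftEndMap C e, leftEndMul_map e⟩
  map_zero' := RightMod.hom_ext _ _ (leftEndMap_zero M)
  map_one' := RightMod.hom_ext _ _ (leftEndMap_id M)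
  map_mul' e e' := RightMod.hom_ext _ _ (leftEndMap_comp e' e)

theorem leftEndPostcomp_injective (M : D) : Function.Injective (leftEndPostcomp C M) :=
  fun _ _ h => leftEndMap_injective M (congrArg RightMod.Hom.hom h)

theorem simple_of_isRightSimplistic_leftEnd [HasKernels C] (hD : IsSemisimpleCat D) {M : D}
    (h : IsRightSimplistic (leftEnd C M)) : Simple M := by
  have := h.2
  refine hD.simple_of_idempotents (mt isZero_leftEnd_iff.2 h.1) fun e he => ?_
  have idempotent : IsIdempotentElem (leftEndPostcomp C M e) :=
    IsIdempotentElem.map (M := End M) he _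
  rcases IsIdempotentElem.iff_eq_zero_or_one.1 idempotent with h0 | h1
  · exact .inl (leftEndPostcomp_injective M (h0.trans (map_zero _).symm))
  · exact .inr (leftEndPostcomp_injective M (h1.trans (map_one _).symm))

theorem isRightSimplistic_leftEnd [RightRigidCategory C] [HasKernels D] (hD : IsSemisimpleCat D)
    (M : D) [Simple M] : IsRightSimplistic (leftEnd C M) := by
  refine isRightSimplistic_of_exists_unit (mt isZero_leftEnd_iff.1 (Simple.not_isZero M))
    fun I i hi => ?_
  have ev_ne_zero := (comp_leftEndEv_eq_zero_iff _).not.2 fun h => hi (RightMod.hom_ext i 0 h)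
  have := hD.isSplitEpi_of_simple ev_ne_zero
  exact exists_unit_of_isSplitEpi_left i.act_hom

end

end LeftModuleCategories

/-! ### Right module categories -/

section RightModuleCategories

open MonoidalRightAction

variable {C : Type u} [Category.{v} C] [MonoidalCategory C]
  {D : Type u₂} [Category.{v₂} D] [MonoidalRightAction C D]

theorem action_coevaluation_evaluation (X Y : C) [ExactPairing X Y] (N : D) :
    (N ⊙ᵣ Y) ⊴ᵣ η_ X Y ≫ (αᵣ (N ⊙ᵣ Y) X Y).hom ≫ (αᵣ N Y X).inv ⊵ᵣ Y ≫ (N ⊴ᵣ ε_ X Y) ⊵ᵣ Y ≫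
      (ρᵣ N).hom ⊵ᵣ Y = (ρᵣ (N ⊙ᵣ Y)).hom := by
  have zigzag : Y ◁ η_ X Y ≫ (α_ Y X Y).inv ≫ ε_ X Y ▷ Y ≫ (λ_ Y).hom = (ρ_ Y).hom := by simp
  have zigzag_action := congrArg (fun f => N ⊴ᵣ f) zigzag
  simp only [actionHomRight_comp, actionHom_leftUnitor, actionHom_rightUnitor,
    whiskerRight_actionHomLeft, actionHomRight_whiskerRight, Category.assoc,
    Iso.inv_hom_id_assoc, cancel_epi] at zigzag_action
  have pentagon : (αᵣ (N ⊙ᵣ Y) X Y).hom ≫ (αᵣ N Y X).inv ⊵ᵣ Y =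
      (αᵣ N Y (X ⊗ Y)).inv ≫ N ⊴ᵣ (α_ Y X Y).inv ≫ (αᵣ N (Y ⊗ X) Y).hom := by
    rw [Iso.eq_inv_comp, ← cancel_epi (N ⊴ᵣ (α_ Y X Y).hom), actionHom_associator_assoc,
      hom_inv_actionHomLeft, Category.comp_id, actionHomRight_hom_inv_assoc]
  rw [← zigzag_action, reassoc_of% pentagon]

/-- The transpose of `s` under the adjunction `- ◁ X ⊣ - ◁ Y` of an exact pairing `(X, Y)`. -/
def rightTranspose (X Y : C) [ExactPairing X Y] {N P : D} (s : N ⟶ P ⊙ᵣ Y) : N ⊙ᵣ X ⟶ P :=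
  s ⊵ᵣ X ≫ (αᵣ P Y X).inv ≫ P ⊴ᵣ ε_ X Y ≫ (ρᵣ P).hom

theorem coevaluation_rightTranspose (X Y : C) [ExactPairing X Y] {N P : D} (s : N ⟶ P ⊙ᵣ Y) :
    N ⊴ᵣ η_ X Y ≫ (αᵣ N X Y).hom ≫ rightTranspose X Y s ⊵ᵣ Y = (ρᵣ N).hom ≫ s := by
  have naturality : (αᵣ N X Y).hom ≫ (s ⊵ᵣ X) ⊵ᵣ Y =
      s ⊵ᵣ (X ⊗ Y) ≫ (αᵣ (P ⊙ᵣ Y) X Y).hom := by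
    rw [actionHomLeft_tensor, Category.assoc, Category.assoc, Iso.inv_hom_id, Category.comp_id]
  simp only [rightTranspose, comp_actionHomLeft]
  rw [reassoc_of% naturality, action_exchange_assoc, action_coevaluation_evaluation,
    actionUnitIso_hom_naturality]

variable [IsClosedRight C D]

theorem exists_comp_rightEv_eq {Y : C} [HasLeftDual Y] {N P : D} (s : N ⟶ P ⊙ᵣ Y) :
    ∃ σ : 𝟙_ C ⟶ (rightHom C N).obj P ⊗ Y,
      N ⊴ᵣ σ ≫ (αᵣ N ((rightHom C N).obj P) Y).hom ≫ rightEv C N P ⊵ᵣ Y = (ρᵣ N).hom ≫ s := by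
  refine ⟨η_ (ᘁY) Y ≫ rightCurry (rightTranspose (ᘁY) Y s) ▷ Y, ?_⟩
  rw [actionHomRight_comp, actionHomRight_whiskerRight]
  simp only [Category.assoc, Iso.inv_hom_id_assoc]
  rw [← comp_actionHomLeft, rightCurry_ev, coevaluation_rightTranspose]

theorem whiskerLeft_rightEndMul_ev {N : D} {Y : C} (j : Y ⟶ rightEnd C N) :
    N ⊴ᵣ (rightEnd C N ◁ j ≫ rightEndMul C N) ≫ rightEndEv C N =
      (αᵣ N (rightEnd C N) Y).hom ≫ rightEndEv C N ⊵ᵣ Y ≫ N ⊴ᵣ j ≫ rightEndEv C N := by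
  rw [actionHomRight_comp, Category.assoc, rightEndMul_ev, whiskerRight_actionHomLeft,
    Category.assoc, Category.assoc, Iso.inv_hom_id_assoc, ← action_exchange_assoc]

variable (C) in
/-- Postcomposition with an endomorphism of `N` on the internal End of `N`. -/
noncomputable def rightEndMap {N : D} (e : N ⟶ N) : rightEnd C N ⟶ rightEnd C N :=
  (rightHom C N).map e

theorem rightEndMap_ev {N : D} (e : N ⟶ N) :
    N ⊴ᵣ rightEndMap C e ≫ rightEndEv C N = rightEndEv C N ≫ e :=
  (rightHomAdj C N).counit.naturality e

theorem rightEndMap_id (N : D) : rightEndMap C (𝟙 N) = 𝟙 (rightEnd C N) :=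
  (rightHom C N).map_id N

theorem rightEndMap_comp {N : D} (e e' : N ⟶ N) :
    rightEndMap C (e ≫ e') = rightEndMap C e ≫ rightEndMap C e' :=
  (rightHom C N).map_comp e e'

theorem rightEndMul_map {N : D} (e : N ⟶ N) :
    rightEndMul C N ≫ rightEndMap C e = rightEnd C N ◁ rightEndMap C e ≫ rightEndMul C N := by
  apply rightEnd_ext
  rw [whiskerLeft_rightEndMul_ev, actionHomRight_comp, Category.assoc, rightEndMap_ev,
    reassoc_of% rightEndMul_ev (C := C) N]

theorem rightEndMap_injective (N : D) :
    Function.Injective (rightEndMap C : (N ⟶ N) → (rightEnd C N ⟶ rightEnd C N)) := by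
  intro e e' h
  have hev : rightEndEv C N ≫ e = rightEndEv C N ≫ e' := by
    rw [← rightEndMap_ev, h, rightEndMap_ev]
  rw [← cancel_epi (ρᵣ N : N ⊙ᵣ 𝟙_ C ≅ N).hom, ← rightEndOne_ev, Category.assoc, Category.assoc,
    hev]

theorem exists_unit_of_isSplitEpi_right {N : D} {Y : C} [HasLeftDual Y]
    {a : rightEnd C N ⊗ Y ⟶ Y} {j : Y ⟶ rightEnd C N}
    (hj : a ≫ j = rightEnd C N ◁ j ≫ rightEndMul C N)
    [IsSplitEpi (N ⊴ᵣ j ≫ rightEndEv C N)] : ∃ u : 𝟙_ C ⟶ Y, u ≫ j = rightEndOne C N := by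
  obtain ⟨σ, hσ⟩ : ∃ σ : 𝟙_ C ⟶ rightEnd C N ⊗ Y, N ⊴ᵣ σ ≫ (αᵣ N (rightEnd C N) Y).hom ≫
      rightEndEv C N ⊵ᵣ Y = (ρᵣ N).hom ≫ section_ (N ⊴ᵣ j ≫ rightEndEv C N) :=
    exists_comp_rightEv_eq _
  refine ⟨σ ≫ a, rightEnd_ext ?_⟩
  rw [Category.assoc, hj, actionHomRight_comp, Category.assoc, whiskerLeft_rightEndMul_ev,
    reassoc_of% hσ, IsSplitEpi.id, Category.comp_id, rightEndOne_ev]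

section

variable [HasZeroMorphisms C] [HasZeroMorphisms D]

theorem comp_rightEndEv_eq_zero_iff {N : D} {Y : C} (j : Y ⟶ rightEnd C N) :
    N ⊴ᵣ j ≫ rightEndEv C N = 0 ↔ j = 0 := by
  have zero_comp_ev : N ⊴ᵣ (0 : Y ⟶ rightEnd C N) ≫ rightEndEv C N = 0 := by
    rw [show N ⊴ᵣ (0 : Y ⟶ rightEnd C N) = 0 from (actionLeft C N).map_zero _ _, zero_comp]
  exact ⟨fun h => rightEnd_ext (h.trans zero_comp_ev.symm), fun h => h ▸ zero_comp_ev⟩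

theorem rightEndMap_zero (N : D) : rightEndMap C (0 : N ⟶ N) = 0 :=
  (comp_rightEndEv_eq_zero_iff _).1 (by rw [rightEndMap_ev, comp_zero])

theorem isZero_rightEnd_iff {N : D} : IsZero (rightEnd C N) ↔ IsZero N := by
  rw [IsZero.iff_id_eq_zero, IsZero.iff_id_eq_zero, ← (rightEndMap_injective (C := C) N).eq_iff,
    rightEndMap_zero, rightEndMap_id]

end

section

variable [Preadditive C] [MonoidalPreadditive C] [Preadditive D]

variable (C) in
/-- The action of `End N` by postcomposition on the internal End of `N`, which commutes with left
multiplication. -/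
noncomputable def rightEndPostcomp (N : D) : End N →*₀ End (Mod.regular (rightEnd C N)) where
  toFun e := LeftMod.mkHom (M := Mod.regular (rightEnd C N)) (N := Mod.regular (rightEnd C N))
    (rightEndMap C e) (rightEndMul_map e)
  map_zero' := Mod.hom_ext _ _ (rightEndMap_zero N)
  map_one' := Mod.hom_ext _ _ (rightEndMap_id N)
  map_mul' e e' := Mod.hom_ext _ _ (rightEndMap_comp e' e)

theorem rightEndPostcomp_injective (N : D) : Function.Injective (rightEndPostcomp C N) :=
  fun _ _ h => rightEndMap_injective N (congrArg Mod.Hom.hom h)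

theorem simple_of_isLeftSimplistic_rightEnd [HasKernels C] (hD : IsSemisimpleCat D) {N : D}
    (h : IsLeftSimplistic (rightEnd C N)) : Simple N := by
  have := h.2
  refine hD.simple_of_idempotents (mt isZero_rightEnd_iff.2 h.1) fun e he => ?_
  have idempotent : IsIdempotentElem (rightEndPostcomp C N e) :=
    IsIdempotentElem.map (M := End N) he _
  rcases IsIdempotentElem.iff_eq_zero_or_one.1 idempotent with h0 | h1
  · exact .inl (rightEndPostcomp_injective N (h0.trans (map_zero _).symm))
  · exact .inr (rightEndPostcomp_injective N (h1.trans (map_one _).symm))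

theorem isLeftSimplistic_rightEnd [LeftRigidCategory C] [HasKernels D] (hD : IsSemisimpleCat D)
    (N : D) [Simple N] : IsLeftSimplistic (rightEnd C N) := by
  refine isLeftSimplistic_of_exists_unit (mt isZero_rightEnd_iff.1 (Simple.not_isZero N))
    fun I i hi => ?_
  have ev_ne_zero := (comp_rightEndEv_eq_zero_iff _).not.2 fun h => hi (Mod.hom_ext i 0 h)
  have := hD.isSplitEpi_of_simple ev_ne_zero
  exact exists_unit_of_isSplitEpi_right (LeftMod.hom_act i)

end

end RightModuleCategories

end DivAlg

theorem mainTheorem3_general {C : Type u} [Category.{v} C] [Preadditive C] [HasKernels C]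
    [MonoidalCategory C] [MonoidalPreadditive C] [RigidCategory C]
    {D : Type*} [Category* D] [Preadditive D] [HasKernels D] [MonoidalLeftAction C D]
    [DivAlg.IsClosedLeft C D]
    {E : Type*} [Category* E] [Preadditive E] [HasKernels E] [MonoidalRightAction C E]
    [DivAlg.IsClosedRight C E] :
    (DivAlg.IsSemisimpleCat D →
      ∀ M : D, DivAlg.IsRightSimplistic (DivAlg.leftEnd C M) ↔ Simple M) ∧
    (DivAlg.IsSemisimpleCat E →
      ∀ N : E, DivAlg.IsLeftSimplistic (DivAlg.rightEnd C N) ↔ Simple N) :=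
  ⟨fun hD M => ⟨DivAlg.simple_of_isRightSimplistic_leftEnd hD,
      fun _ => DivAlg.isRightSimplistic_leftEnd hD M⟩,
    fun hE N => ⟨DivAlg.simple_of_isLeftSimplistic_rightEnd hE,
      fun _ => DivAlg.isLeftSimplistic_rightEnd hE N⟩⟩

theorem mainTheorem3 {k : Type w} [Field k] [IsAlgClosed k] [CharZero k]
    {C : Type u} [Category.{v} C] [Abelian C] [Linear k C] [MonoidalCategory C]
    [MonoidalPreadditive C] [MonoidalLinear k C] [RigidCategory C] [DivAlg.IsMultifusion k C]
    (A : C) [MonObj A] :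
    (DivAlg.OstrikLeft C (DivAlg.RightMod A) →
      ∀ M : DivAlg.RightMod A, DivAlg.IsRightSimplistic (DivAlg.leftEnd C M) ↔ Simple M) ∧
    (DivAlg.OstrikRight C (Mod C A) →
      ∀ N : Mod C A, DivAlg.IsLeftSimplistic (DivAlg.rightEnd C N) ↔ Simple N) :=
  have general := mainTheorem3_general (C := C) (D := DivAlg.RightMod A) (E := Mod C A)
  ⟨fun h => general.1 h.semisimple, fun h => general.2 h.semisimple⟩
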